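/- Let $d,n_1,n_2\ge 0$ be integers, $\kappa_1,\dots,\kappa_{n_1}\in\mathbb R$ with $\kappa_i^2>0$, $\alpha_1,\dots,\alpha_{n_1}\in\mathbb N$, $b_1,\dots,b_{n_2}\in\mathbb R$, $\mathbf B_1,\dots,\mathbf B_{n_2}\in\mathbb R^d$ and $\phi\in\mathbb R$. A (second-order, generalized) random field on $\mathbb R^d$ is a continuous linear map $f\mapsto X(f)=\text{``}\int f(\mathbf s)X(\mathbf s)\,d\mathbf s\text{''}$ from the Schwartz functions on $\mathbb R^d$ to the square-integrable random variables of a probability space. Let $\mathcal W$ be Gaussian white noise (for real $f$, $\mathcal W(f)$ is a centred real Gaussian variable with variance $\int f^2$), and let the random field $X$ solve $$\Bigl(\prod_{i=1}^{n_1}(\kappa_i^2-\Delta)^{\alpha_i/2}\Bigr)X=\Bigl(\prod_{j=1}^{n_2}(b_j+\mathbf B_j^{\top}\nabla)\Bigr)\phi\,\mathcal W$$ in the sense of tempered distributions, where $(\kappa^2-\Delta)^{\alpha/2}$ is the Fourier multiplier with symbol $(\kappa^2+\|\mathbf k\|^2)^{\alpha/2}$. Then $X$ is wide-sense stationary with spectral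 density $$S(\mathbf k)=\frac{\phi^2}{(2\pi)^d}\,\frac{\prod_{j=1}^{n_2}(b_j^2+\mathbf k^{\top}\mathbf B_j\mathbf B_j^{\top}\mathbf k)}{\prod_{j=1}^{n_1}(\kappa_j^2+\|\mathbf k\|^2)^{\alpha_j}}.$$ That is, the mean of $X$ is constant and, for all Schwartz functions $f,g$, $$\operatorname{Cov}(X(f),X(g))=\int_{\mathbb R^d}\hat f(\mathbf k)\,\overline{\hat g(\mathbf k)}\,S(\mathbf k)\,d\mathbf k,\qquad \hat f(\mathbf k)=\int_{\mathbb R^d} e^{i\mathbf k^{\top}\mathbf s}f(\mathbf s)\,d\mathbf s,$$ with an absolutely convergent integral. If moreover $X$ is represented by an ordinary mean-square continuous field $X(\mathbf s)$, $\mathbf s\in\mathbb R^d$, that is, $X(f)=\int f(\mathbf s)X(\mathbf s)\,d\mathbf s$ for all compactly supported smooth $f$, then $S$ is integrable, $X(\mathbf s)$ has constant mean, and $\operatorname{Cov}(X(\mathbf s),X(\mathbf t))=\int_{\mathbb R^d} e^{i\mathbf k^{\top}(\mathbf s-\mathbf t)}S(\mathbf k)\,d\mathbf k$ for all $\mathbf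 s,\mathbf t\in\mathbb R^d$. -/

import Mathlib

open MeasureTheory ProbabilityTheory FourierTransform
open scoped SchwartzMap LineDeriv

noncomputable section

namespace NestedSPDE

/-- The space `ℝ^d` with its Euclidean structure. -/
abbrev Space (d : ℕ) : Type := EuclideanSpace ℝ (Fin d)

/-- Second-order generalized random fields on `ℝ^d` over the probability space `(Ω, P)`:
continuous linear maps from Schwartz test functions to square-integrable random variables,
that is, `L²(P)`-valued tempered distributions. An ordinary field `s ↦ X(s)` acts by
`f ↦ ∫ f(s) X(s) ds`. -/
abbrev RandomField (d : ℕ) {Ω : Type*} [MeasurableSpace Ω] (P : Measure Ω) : Type _ :=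
  𝓢'(Space d, Lp ℂ 2 P)

section Operators

variable {d : ℕ} {F : Type*} [NormedAddCommGroup F] [NormedSpace ℂ F]

variable (d F) in
/-- The operator `(κ² - Δ)^(α/2)` on tempered distributions: the Fourier multiplier with symbol
`(κ² + ‖k‖²)^(α/2)`, `k` the angular frequency. Mathlib's Fourier transform uses `exp(-2πi⟨s, ξ⟩)`,
so that `k = 2πξ`. -/
def maternOp (κ : ℝ) (α : ℕ) : 𝓢'(Space d, F) →L[ℂ] 𝓢'(Space d, F) :=
  TemperedDistribution.fourierMultiplierCLM F
    (fun ξ ↦ (((κ ^ 2 + ‖(2 * Real.pi) • ξ‖ ^ 2) ^ ((α : ℝ) / 2) : ℝ) : ℂ))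

variable (F) in
/-- The operator `b + Bᵀ∇` on tempered distributions. -/
def gradOp (b : ℝ) (B : Space d) : 𝓢'(Space d, F) →L[ℂ] 𝓢'(Space d, F) :=
  (b : ℂ) • ContinuousLinearMap.id ℂ 𝓢'(Space d, F) +
    LineDeriv.lineDerivOpCLM ℂ 𝓢'(Space d, F) B

variable (d F) in
/-- `ℒ₁ = ∏ᵢ (κᵢ² - Δ)^(αᵢ/2)`, the product being composition of operators. -/
def opL₁ {n₁ : ℕ} (κ : Fin n₁ → ℝ) (α : Fin n₁ → ℕ) :
    𝓢'(Space d, F) →L[ℂ] 𝓢'(Space d, F) :=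
  (List.ofFn fun i ↦ maternOp d F (κ i) (α i)).prod

variable (F) in
/-- `ℒ₂ = ∏ⱼ (bⱼ + Bⱼᵀ∇)`, the product being composition of operators. -/
def opL₂ {n₂ : ℕ} (b : Fin n₂ → ℝ) (B : Fin n₂ → Space d) :
    𝓢'(Space d, F) →L[ℂ] 𝓢'(Space d, F) :=
  (List.ofFn fun j ↦ gradOp F (b j) (B j)).prod

end Operators

section RandomFields

variable {d : ℕ} {Ω : Type*} [MeasurableSpace Ω] {P : Measure Ω}

/-- Gaussian white noise on `ℝ^d`: on every real test function `f` it is a real centred Gaussian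
variable with variance `∫ f²` (joint Gaussianity and the covariance `∫ f g` follow by linearity). -/
def IsGaussianWhiteNoise (W : RandomField d P) : Prop :=
  ∀ f : 𝓢(Space d, ℂ), (∀ x, (f x).im = 0) →
    HasLaw (fun ω ↦ W f ω)
      ((gaussianReal 0 (Real.toNNReal (∫ x, (f x).re ^ 2))).map (fun x : ℝ ↦ (x : ℂ))) P

/-- Covariance `E[(U - EU) conj(V - EV)]` of square-integrable complex random variables. -/
def covar (U V : Lp ℂ 2 P) : ℂ :=
  ∫ ω, (U ω - ∫ ω', U ω' ∂P) * (starRingEnd ℂ) (V ω - ∫ ω', V ω' ∂P) ∂P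

/-- `∫ exp(i kᵀs) f(s) ds`. -/
def angularTransform (f : 𝓢(Space d, ℂ)) (k : Space d) : ℂ :=
  ∫ s, Complex.exp (Complex.I * (inner ℝ k s : ℝ)) * f s

/-- The generalized random field `X` is wide-sense stationary with spectral density `S`: its mean is
a constant function, and formally `Cov(X(s), X(t)) = ∫ exp(i kᵀ(s-t)) S(k) dk`, that is,
`Cov(X(f), X(g)) = ∫ (∫ exp(i kᵀs) f(s) ds) conj(∫ exp(i kᵀt) g(t) dt) S(k) dk` for all test
functions, the integral over `k` converging absolutely. -/
def HasSpectralDensity (X : RandomField d P) (S : Space d → ℝ) : Prop :=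
  Measurable S ∧ (∀ k, 0 ≤ S k) ∧
  (∃ m : ℂ, ∀ f : 𝓢(Space d, ℂ), ∫ ω, X f ω ∂P = m * ∫ s, f s) ∧
  ∀ f g : 𝓢(Space d, ℂ),
    Integrable (fun k ↦ angularTransform f k * (starRingEnd ℂ) (angularTransform g k) * (S k : ℂ)) ∧
    covar (X f) (X g) =
      ∫ k, angularTransform f k * (starRingEnd ℂ) (angularTransform g k) * (S k : ℂ)

/-- The ordinary mean-square continuous field `s ↦ Y(s)` represents the generalized field `X`:
`X(f) = ∫ f(s) Y(s) ds` for all compactly supported test functions `f`. -/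
def IsRepresentedBy (X : RandomField d P) (Y : Space d → Lp ℂ 2 P) : Prop :=
  Continuous Y ∧
  ∀ f : 𝓢(Space d, ℂ), HasCompactSupport (f : Space d → ℂ) → X f = ∫ s, f s • Y s

/-- The ordinary field `Y` is wide-sense stationary with (integrable) spectral density `S`: its mean
is constant and `Cov(Y(s), Y(t)) = ∫ exp(i kᵀ(s-t)) S(k) dk`. -/
def HasPointwiseSpectralDensity (Y : Space d → Lp ℂ 2 P) (S : Space d → ℝ) : Prop :=
  Integrable S ∧ (∀ k, 0 ≤ S k) ∧
  (∃ m : ℂ, ∀ s, ∫ ω, Y s ω ∂P = m) ∧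
  ∀ s t, covar (Y s) (Y t) =
    ∫ k, Complex.exp (Complex.I * (inner ℝ k (s - t) : ℝ)) * (S k : ℂ)

end RandomFields

end NestedSPDE

end

/-! Under the Fourier transform both operators become multiplications, with factors (κ² +
‖k‖²)^(α/2) and b + i Bᵀk. As κ² > 0, the Matérn symbols have reciprocals of temperate growth, so
the equation determines X as the multiplier a, the quotient of the symbols, applied to φW
(`eq_fourierMultiplierCLM_of_opL₁_eq_opL₂`).

White noise is isometric from test functions with the L² norm to L²(P)
(`IsGaussianWhiteNoise.inner_eq`). Transferring a to the test functions and applying Plancherel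
gives the covariance with weight φ²|a|²; the factor (2π)^(-d) comes from k = 2πξ
(`IsGaussianWhiteNoise.hasSpectralDensity`).

For a mean-square continuous field, test against bumps shrinking to points. Fatou's lemma bounds ∫ S
by the variance at the origin; S then dominates the mollified integrands, and the covariance formula
passes to the limit (`HasSpectralDensity.pointwise`). -/

noncomputable section

namespace NestedSPDE

/-- The symbol of `(κ² - Δ)^r` in Mathlib's frequency variable. -/
def maternSymbol {d : ℕ} (κ r : ℝ) (ξ : Space d) : ℝ :=
  (κ ^ 2 + ‖(2 * Real.pi) • ξ‖ ^ 2) ^ r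

/-- The symbol of `b + Bᵀ∇` in Mathlib's frequency variable. -/
def gradSymbol {d : ℕ} (b : ℝ) (B : Space d) (ξ : Space d) : ℂ :=
  b + 2 * Real.pi * Complex.I * (inner ℝ ξ B : ℝ)

/-! ### Growth and moduli of the symbols -/

section Symbols

variable {d : ℕ}

/-- Factoring out κ² and rescaling ξ by 2π/κ reduces to (1 + ‖x‖²)^r. Negative r matters: it makes
the reciprocal symbol a legitimate multiplier. -/
theorem maternSymbol_hasTemperateGrowth {κ : ℝ} (hκ : 0 < κ ^ 2) (r : ℝ) :
    (fun ξ : Space d ↦ (maternSymbol κ r ξ : ℂ)).HasTemperateGrowth := by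
  have hκ0 : κ ≠ 0 := by rintro rfl; simp at hκ
  have h : (fun ξ : Space d ↦ (maternSymbol κ r ξ : ℂ)) = Complex.ofReal ∘
      fun ξ ↦ (κ ^ 2) ^ r * ((fun x : Space d ↦ (1 + ‖x‖ ^ 2) ^ r) ∘
        ((2 * Real.pi / κ) • ContinuousLinearMap.id ℝ (Space d))) ξ := by
    funext ξ
    simp only [Function.comp, maternSymbol]
    rw [← Real.mul_rpow hκ.le (by positivity)]
    congr 2
    simp only [_root_.smul_apply, ContinuousLinearMap.id_apply, norm_smul, norm_div,
      Real.norm_eq_abs, mul_pow, div_pow, sq_abs]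
    field_simp
  rw [h]
  exact Function.Complex.hasTemperateGrowth_ofReal.comp
    ((Function.HasTemperateGrowth.const _).mul
      ((Function.hasTemperateGrowth_one_add_norm_sq_rpow (Space d) r).comp
        (ContinuousLinearMap.hasTemperateGrowth _)))

theorem gradSymbol_hasTemperateGrowth (b : ℝ) (B : Space d) :
    (gradSymbol b B).HasTemperateGrowth := by
  unfold gradSymbol
  fun_prop

theorem hasTemperateGrowth_prod {n : ℕ} {g : Fin n → Space d → ℂ}
    (hg : ∀ i, (g i).HasTemperateGrowth) : (∏ i, g i).HasTemperateGrowth := by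
  induction n with
  | zero => exact Function.HasTemperateGrowth.const (E := Space d) (1 : ℂ)
  | succ n ih =>
    rw [Fin.prod_univ_succ]
    exact (hg 0).mul (ih fun i ↦ hg i.succ)

theorem maternSymbol_sq {κ : ℝ} (hκ : 0 < κ ^ 2) (α : ℕ) (ξ : Space d) :
    maternSymbol κ ((α : ℝ) / 2) ξ ^ 2 = (κ ^ 2 + ‖(2 * Real.pi) • ξ‖ ^ 2) ^ α := by
  rw [maternSymbol, ← Real.rpow_natCast, ← Real.rpow_mul (by positivity)]
  simp

theorem norm_gradSymbol_sq (b : ℝ) (B ξ : Space d) :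
    ‖gradSymbol b B ξ‖ ^ 2 = b ^ 2 + ((2 * Real.pi) • ξ).ofLp ⬝ᵥ
      (Matrix.vecMulVec B.ofLp B.ofLp).mulVec ((2 * Real.pi) • ξ).ofLp := by
  have hin : inner ℝ ξ B = ξ.ofLp ⬝ᵥ B.ofLp := by
    simp [EuclideanSpace.inner_eq_star_dotProduct, dotProduct_comm]
  have h : gradSymbol b B ξ = (b : ℂ) + ((2 * Real.pi * inner ℝ ξ B : ℝ) : ℂ) * Complex.I := by
    simp only [gradSymbol]; push_cast; ring
  rw [h, ← Complex.normSq_eq_norm_sq, Complex.normSq_add_mul_I, hin, Matrix.vecMulVec_mulVec]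
  simp [dotProduct_comm]
  ring

end Symbols

/-! ### Both operators as Fourier multipliers, and inversion of `opL₁` -/

section Operators

variable {d : ℕ} (F : Type*) [NormedAddCommGroup F] [NormedSpace ℂ F]

theorem gradOp_eq_fourierMultiplierCLM (b : ℝ) (B : Space d) :
    gradOp F b B = TemperedDistribution.fourierMultiplierCLM F (gradSymbol b B) := by
  have h : gradSymbol b B = fun ξ ↦ ∑ i : Fin 2,
      (![fun _ ↦ (b : ℂ), (2 * Real.pi * Complex.I) • fun ξ : Space d ↦ ((inner ℝ ξ B : ℝ) : ℂ)]
        i : Space d → ℂ) ξ := by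
    funext ξ
    simp [gradSymbol]
  rw [h, TemperedDistribution.fourierMultiplierCLM_sum]
  · rw [Fin.sum_univ_two]
    simp only [Matrix.cons_val_zero, Matrix.cons_val_one]
    rw [TemperedDistribution.fourierMultiplierCLM_const,
      TemperedDistribution.fourierMultiplierCLM_smul (by fun_prop)]
    ext1 T
    simp [gradOp, TemperedDistribution.lineDeriv_eq_fourierMultiplierCLM]
  · intro i _
    fin_cases i
    · exact Function.HasTemperateGrowth.const _
    · simp only [Fin.mk_one, Matrix.cons_val_one]
      exact (Function.HasTemperateGrowth.const _).mul (by fun_prop)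

theorem prod_ofFn_fourierMultiplierCLM {n : ℕ} {g : Fin n → Space d → ℂ}
    (hg : ∀ i, (g i).HasTemperateGrowth) :
    (List.ofFn fun i ↦ TemperedDistribution.fourierMultiplierCLM F (g i)).prod =
      TemperedDistribution.fourierMultiplierCLM F (∏ i, g i) := by
  induction n with
  | zero =>
    simp only [List.ofFn_zero, List.prod_nil, Finset.univ_eq_empty, Finset.prod_empty]
    exact ((TemperedDistribution.fourierMultiplierCLM_const (1 : ℂ)).trans (one_smul _ _)).symm
  | succ n ih =>
    rw [List.ofFn_succ, List.prod_cons, ih fun i ↦ hg i.succ, Fin.prod_univ_succ, mul_comm (g 0)]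
    exact TemperedDistribution.fourierMultiplierCLM_compL_fourierMultiplierCLM
      (hasTemperateGrowth_prod fun i ↦ hg i.succ) (hg 0)

variable {F}

/-- The solution of `ℒ₁ X = ℒ₂ W` is obtained from `W` by a Fourier multiplier. -/
theorem eq_fourierMultiplierCLM_of_opL₁_eq_opL₂ {n₁ n₂ : ℕ} {κ : Fin n₁ → ℝ}
    (hκ : ∀ i, 0 < κ i ^ 2) {α : Fin n₁ → ℕ} {b : Fin n₂ → ℝ} {B : Fin n₂ → Space d}
    {X W : 𝓢'(Space d, F)} (h : opL₁ d F κ α X = opL₂ F b B W) :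
    X = TemperedDistribution.fourierMultiplierCLM F
      ((∏ j, gradSymbol (b j) (B j)) * ∏ i, fun ξ ↦ (maternSymbol (κ i) (-((α i : ℝ) / 2)) ξ : ℂ))
        W := by
  have hm (r : Fin n₁ → ℝ) := fun i ↦ maternSymbol_hasTemperateGrowth (d := d) (hκ i) (r i)
  have h₁ : opL₁ d F κ α = TemperedDistribution.fourierMultiplierCLM F
      (∏ i, fun ξ ↦ (maternSymbol (κ i) ((α i : ℝ) / 2) ξ : ℂ)) :=
    prod_ofFn_fourierMultiplierCLM F (hm _)
  have h₂ : opL₂ F b B = TemperedDistribution.fourierMultiplierCLM F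
      (∏ j, gradSymbol (b j) (B j)) := by
    simp only [opL₂, gradOp_eq_fourierMultiplierCLM]
    exact prod_ofFn_fourierMultiplierCLM F fun j ↦ gradSymbol_hasTemperateGrowth _ _
  rw [h₁, h₂] at h
  -- Splitting the multiplier exposes the right-hand side of the equation; replacing it by the
  -- left-hand side leaves a symbol times its reciprocal acting on X.
  rw [← TemperedDistribution.fourierMultiplierCLM_fourierMultiplierCLM_apply
    (hasTemperateGrowth_prod fun j ↦ gradSymbol_hasTemperateGrowth _ _)
    (hasTemperateGrowth_prod (hm _)), ← h,
    TemperedDistribution.fourierMultiplierCLM_fourierMultiplierCLM_apply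
    (hasTemperateGrowth_prod (hm _)) (hasTemperateGrowth_prod (hm _))]
  have hone : (∏ i, fun ξ : Space d ↦ (maternSymbol (κ i) ((α i : ℝ) / 2) ξ : ℂ)) *
      (∏ i, fun ξ ↦ (maternSymbol (κ i) (-((α i : ℝ) / 2)) ξ : ℂ)) = fun _ ↦ 1 := by
    rw [← Finset.prod_mul_distrib]
    funext ξ
    rw [Finset.prod_apply]
    refine Finset.prod_eq_one fun i _ ↦ ?_
    have := hκ i
    simp only [Pi.mul_apply, maternSymbol]
    rw [← Complex.ofReal_mul, ← Real.rpow_add (by positivity)]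
    simp
  rw [hone]
  simp

end Operators

/-! ### Covariance as a continuous function on L²(P) -/

section Covariance

variable {Ω : Type*} [MeasurableSpace Ω] {P : Measure Ω} [IsProbabilityMeasure P]

theorem integral_eq_inner_const (U : Lp ℂ 2 P) :
    ∫ ω, U ω ∂P = inner ℂ (Lp.const 2 P (1 : ℂ)) U := by
  rw [L2.inner_def]
  refine integral_congr_ae ?_
  filter_upwards [Lp.coeFn_const (p := 2) (μ := P) (1 : ℂ)] with ω h
  rw [h]
  simp

theorem continuous_integral_L2 : Continuous fun U : Lp ℂ 2 P ↦ ∫ ω, U ω ∂P := by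
  simp only [integral_eq_inner_const]
  fun_prop

/-- Centring subtracts the projection onto the unit vector 1, since P is a probability measure. The
arguments swap because the inner product is conjugate-linear in its first slot. -/
theorem covar_eq_inner_sub (U V : Lp ℂ 2 P) :
    covar U V = inner ℂ V U - (∫ ω, U ω ∂P) * (starRingEnd ℂ) (∫ ω, V ω ∂P) := by
  have hc (c : ℂ) : ∀ᵐ ω ∂P, Lp.const 2 P c ω = c :=
    Lp.coeFn_const (p := 2) (μ := P) c
  have h : covar U V = inner ℂ (V - Lp.const 2 P (∫ ω, V ω ∂P)) (U - Lp.const 2 P (∫ ω, U ω ∂P)) := by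
    rw [L2.inner_def]
    refine integral_congr_ae ?_
    filter_upwards [hc (∫ ω, U ω ∂P), hc (∫ ω, V ω ∂P), Lp.coeFn_sub U (Lp.const 2 P (∫ ω, U ω ∂P)),
      Lp.coeFn_sub V (Lp.const 2 P (∫ ω, V ω ∂P))] with ω h1 h2 h3 h4
    rw [h3, h4, Pi.sub_apply, Pi.sub_apply, h1, h2]
    simp
  have hs (c : ℂ) : Lp.const 2 P c = c • Lp.const 2 P (1 : ℂ) := by
    have := map_smul (Lp.constL (p := 2) (μ := P) (𝕜 := ℂ) (E := ℂ)) c (1 : ℂ)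
    simpa using! this
  have h1 : inner ℂ (Lp.const 2 P (1 : ℂ)) (Lp.const 2 P (1 : ℂ)) = (1 : ℂ) := by
    rw [← integral_eq_inner_const, integral_congr_ae (hc 1)]; simp
  rw [h, hs (∫ ω, V ω ∂P), hs (∫ ω, U ω ∂P)]
  simp only [inner_sub_left, inner_sub_right, inner_smul_left, inner_smul_right, h1,
    ← integral_eq_inner_const]
  rw [← inner_conj_symm V (Lp.const 2 P (1 : ℂ)), ← integral_eq_inner_const]
  ring

theorem continuous_covar : Continuous fun p : Lp ℂ 2 P × Lp ℂ 2 P ↦ covar p.1 p.2 := by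
  simp only [covar_eq_inner_sub]
  have h := continuous_integral_L2 (P := P)
  have h1 := h.comp (continuous_fst (X := Lp ℂ 2 P) (Y := Lp ℂ 2 P))
  have h2 := h.comp (continuous_snd (X := Lp ℂ 2 P) (Y := Lp ℂ 2 P))
  exact (continuous_snd.inner continuous_fst).sub (h1.mul (Complex.continuous_conj.comp h2))

end Covariance

/-! ### White noise as an L² isometry -/

section WhiteNoise

variable {d : ℕ} {Ω : Type*} [MeasurableSpace Ω] {P : Measure Ω}

/-- The real part of a Schwartz function, as a complex-valued Schwartz function. -/
def schwartzRe (f : 𝓢(Space d, ℂ)) : 𝓢(Space d, ℂ) :=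
  SchwartzMap.postcompCLM (𝕜 := ℝ) (Complex.ofRealCLM ∘L Complex.reCLM) f

@[simp]
theorem schwartzRe_apply (f : 𝓢(Space d, ℂ)) (x : Space d) : schwartzRe f x = ((f x).re : ℂ) :=
  rfl

theorem schwartzRe_add_I_smul (f : 𝓢(Space d, ℂ)) :
    schwartzRe f + Complex.I • schwartzRe (-Complex.I • f) = f := by
  ext x
  simp [Complex.ext_iff]

variable {W : RandomField d P}

theorem IsGaussianWhiteNoise.integral_of_real (hW : IsGaussianWhiteNoise W) {f : 𝓢(Space d, ℂ)}
    (hf : ∀ x, (f x).im = 0) : ∫ ω, W f ω ∂P = 0 := by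
  have h := (hW f hf).integral_comp (f := id) (by fun_prop)
  simp only [Function.comp_def, id] at h
  rw [h, integral_map (by fun_prop) (by fun_prop), integral_complex_ofReal,
    integral_id_gaussianReal]
  simp

theorem IsGaussianWhiteNoise.im_eq_zero (hW : IsGaussianWhiteNoise W) {f : 𝓢(Space d, ℂ)}
    (hf : ∀ x, (f x).im = 0) : ∀ᵐ ω ∂P, (W f ω).im = 0 := by
  have hm : MeasurableSet {z : ℂ | z.im = 0} :=
    measurableSet_eq_fun Complex.measurable_im measurable_const
  refine ((hW f hf).ae_iff (p := fun z : ℂ ↦ z.im = 0) (measurableSet_setOfPred.1 hm)).2 ?_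
  rw [ae_map_iff (by fun_prop) hm]
  simp

theorem IsGaussianWhiteNoise.norm_sq_of_real (hW : IsGaussianWhiteNoise W) {f : 𝓢(Space d, ℂ)}
    (hf : ∀ x, (f x).im = 0) : ‖W f‖ ^ 2 = ‖f.toLp 2‖ ^ 2 := by
  have h := (hW f hf).integral_comp (f := fun z : ℂ ↦ ‖z‖ ^ 2) (by fun_prop)
  have hL : ‖W f‖ ^ 2 = ∫ ω, ‖W f ω‖ ^ 2 ∂P := by
    rw [← Complex.ofReal_inj, ← integral_complex_ofReal]
    push_cast
    refine (inner_self_eq_norm_sq_to_K (𝕜 := ℂ) (W f)).symm.trans ?_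
    rw [L2.inner_def]
    simp [inner_self_eq_norm_sq_to_K]
  have hR : ‖f.toLp 2‖ ^ 2 = ∫ x, (f x).re ^ 2 := by
    rw [← Complex.ofReal_inj, ← integral_complex_ofReal]
    push_cast
    refine (inner_self_eq_norm_sq_to_K (𝕜 := ℂ) (f.toLp 2 volume)).symm.trans ?_
    rw [SchwartzMap.inner_toL2_toL2_eq f f volume]
    refine integral_congr_ae (.of_forall fun x ↦ ?_)
    have : f x = (f x).re := Complex.ext rfl (by simpa using hf x)
    beta_reduce
    rw [this, RCLike.inner_apply', Complex.conj_ofReal, Complex.ofReal_re, sq]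
  simp only [Function.comp_def] at h
  rw [hL, hR, h, integral_map (by fun_prop) (by fun_prop)]
  simp only [Complex.norm_real, Real.norm_eq_abs, sq_abs]
  have := variance_id_gaussianReal (μ := 0) (v := Real.toNNReal (∫ x, (f x).re ^ 2))
  rw [variance_of_integral_eq_zero (by fun_prop) (by simp)] at this
  have hnn : 0 ≤ ∫ x, (f x).re ^ 2 := integral_nonneg fun x ↦ sq_nonneg _
  simpa [hnn] using this

theorem inner_eq_zero_im {U V : Lp ℂ 2 P} (hU : ∀ᵐ ω ∂P, (U ω).im = 0)
    (hV : ∀ᵐ ω ∂P, (V ω).im = 0) : (inner ℂ U V : ℂ).im = 0 := by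
  rw [← Complex.conj_eq_iff_im, inner_conj_symm, L2.inner_def, L2.inner_def]
  refine integral_congr_ae ?_
  filter_upwards [hU, hV] with ω h1 h2
  simp [Complex.conj_eq_iff_im.2 h1, Complex.conj_eq_iff_im.2 h2, mul_comm]

theorem norm_add_I_smul_sq {E : Type*} [NormedAddCommGroup E] [InnerProductSpace ℂ E] {u v : E}
    (h : (inner ℂ u v : ℂ).im = 0) : ‖u + Complex.I • v‖ ^ 2 = ‖u‖ ^ 2 + ‖v‖ ^ 2 := by
  rw [norm_add_sq (𝕜 := ℂ), inner_smul_right, norm_smul]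
  simp [h]

/-- With f = u + iv, the inner product of the two real parts is real, both in L²(P) and in L²(ℝ^d),
so the cross term has no real part and the real case suffices. -/
theorem IsGaussianWhiteNoise.norm_sq (hW : IsGaussianWhiteNoise W) (f : 𝓢(Space d, ℂ)) :
    ‖W f‖ ^ 2 = ‖f.toLp 2‖ ^ 2 := by
  have hre (g : 𝓢(Space d, ℂ)) (x : Space d) : (schwartzRe g x).im = 0 := by simp
  have hlp (g : 𝓢(Space d, ℂ)) : ∀ᵐ x, ((schwartzRe g).toLp 2 volume x).im = 0 := by
    filter_upwards [(schwartzRe g).coeFn_toLp 2 volume] with x hx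
    rw [hx, hre]
  rw [← schwartzRe_add_I_smul f, map_add, map_smul,
    norm_add_I_smul_sq (inner_eq_zero_im (hW.im_eq_zero (hre _)) (hW.im_eq_zero (hre _))),
    ← SchwartzMap.toLpCLM_apply (𝕜 := ℂ), map_add, map_smul]
  simp only [SchwartzMap.toLpCLM_apply]
  rw [norm_add_I_smul_sq (inner_eq_zero_im (hlp _) (hlp _)), hW.norm_sq_of_real (hre _),
    hW.norm_sq_of_real (hre _)]

theorem IsGaussianWhiteNoise.inner_eq (hW : IsGaussianWhiteNoise W) (f g : 𝓢(Space d, ℂ)) :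
    inner ℂ (W f) (W g) = ∫ x, (starRingEnd ℂ) (f x) * g x := by
  have h (f : 𝓢(Space d, ℂ)) : ‖W f‖ = ‖SchwartzMap.toLpCLM ℂ ℂ 2 volume f‖ := by
    have := hW.norm_sq f
    rwa [sq_eq_sq₀ (norm_nonneg _) (norm_nonneg _)] at this
  have h2 : inner ℂ (W f) (W g) = inner ℂ (f.toLp 2 volume) (g.toLp 2 volume) := by
    -- Polarization: a linear map preserving norms preserves inner products.
    rw [inner_eq_sum_norm_sq_div_four, inner_eq_sum_norm_sq_div_four]
    simp only [← map_smul, ← map_add, ← map_sub, h, ← SchwartzMap.toLpCLM_apply (𝕜 := ℂ)]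
  rw [h2, SchwartzMap.inner_toL2_toL2_eq f g volume]
  simp [mul_comm]

theorem IsGaussianWhiteNoise.integral_eq_zero [IsProbabilityMeasure P]
    (hW : IsGaussianWhiteNoise W) (f : 𝓢(Space d, ℂ)) : ∫ ω, W f ω ∂P = 0 := by
  have hre (g : 𝓢(Space d, ℂ)) (x : Space d) : (schwartzRe g x).im = 0 := by simp
  rw [integral_eq_inner_const, ← schwartzRe_add_I_smul f, map_add, map_smul, inner_add_right,
    inner_smul_right, ← integral_eq_inner_const, ← integral_eq_inner_const,
    hW.integral_of_real (hre _), hW.integral_of_real (hre _)]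
  simp

end WhiteNoise

/-! ### Spectral density of filtered white noise -/

section SpectralDensity

variable {d : ℕ}

theorem angularTransform_two_pi_smul (f : 𝓢(Space d, ℂ)) (ξ : Space d) :
    angularTransform f ((2 * Real.pi) • ξ) = (𝓕⁻ f) ξ := by
  rw [SchwartzMap.fourierInv_coe, Real.fourierInv_eq', angularTransform]
  refine integral_congr_ae (.of_forall fun v ↦ ?_)
  beta_reduce
  rw [smul_eq_mul, real_inner_smul_left, real_inner_comm, mul_comm Complex.I]

/-- Change of variables `k = 2πξ` from ordinary to angular frequency. -/
theorem integral_angular (F : Space d → ℂ) :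
    ∫ k, F k = (2 * Real.pi) ^ d * ∫ ξ, F ((2 * Real.pi) • ξ) := by
  have h := Measure.integral_comp_smul (volume : Measure (Space d)) F (2 * Real.pi)
  have hpos : (0 : ℝ) < (2 * Real.pi) ^ d := by positivity
  rw [finrank_euclideanSpace_fin, abs_of_pos (by positivity)] at h
  rw [h, Complex.real_smul]
  push_cast
  rw [← mul_assoc, mul_inv_cancel₀ (by exact_mod_cast hpos.ne'), one_mul]

variable {Ω : Type*} [MeasurableSpace Ω] {P : Measure Ω} [IsProbabilityMeasure P]

/-- A Fourier multiplier applied to Gaussian white noise is a stationary field. -/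
theorem IsGaussianWhiteNoise.hasSpectralDensity {W : RandomField d P}
    (hW : IsGaussianWhiteNoise W) (φ : ℝ) {a : Space d → ℂ} (ha : a.HasTemperateGrowth)
    {S : Space d → ℝ} (hSm : Measurable S)
    (hS : ∀ ξ, S ((2 * Real.pi) • ξ) = φ ^ 2 / (2 * Real.pi) ^ d * ‖a ξ‖ ^ 2) :
    HasSpectralDensity (TemperedDistribution.fourierMultiplierCLM _ a ((φ : ℂ) • W)) S := by
  set X := TemperedDistribution.fourierMultiplierCLM _ a ((φ : ℂ) • W)
  let v (f : 𝓢(Space d, ℂ)) : 𝓢(Space d, ℂ) := SchwartzMap.smulLeftCLM ℂ a (𝓕⁻ f)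
  have hv f ξ : v f ξ = a ξ * (𝓕⁻ f) ξ := SchwartzMap.smulLeftCLM_apply_apply ha _ _
  -- Multipliers act on distributions by duality, so a falls on the inverse transform of the test
  -- function.
  have hX f : X f = (φ : ℂ) • W (𝓕 (v f)) := rfl
  have hmean f : ∫ ω, X f ω ∂P = 0 := by
    rw [integral_eq_inner_const, hX, inner_smul_right, ← integral_eq_inner_const,
      hW.integral_eq_zero, mul_zero]
  have hpos : (0 : ℝ) < (2 * Real.pi) ^ d := by positivity
  have hF f g ξ : angularTransform f ((2 * Real.pi) • ξ) *
      (starRingEnd ℂ) (angularTransform g ((2 * Real.pi) • ξ)) * (S ((2 * Real.pi) • ξ) : ℂ) =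
      ((φ : ℂ) ^ 2 / (2 * Real.pi) ^ d) * ((starRingEnd ℂ) (v g ξ) * v f ξ) := by
    rw [angularTransform_two_pi_smul, angularTransform_two_pi_smul, hS, hv, hv, map_mul]
    push_cast
    rw [← Complex.conj_mul']
    ring
  refine ⟨hSm, fun k ↦ ?_, ⟨0, fun f ↦ by rw [hmean, zero_mul]⟩, fun f g ↦ ⟨?_, ?_⟩⟩
  · have h := hS ((2 * Real.pi)⁻¹ • k)
    rw [smul_inv_smul₀ (by positivity)] at h
    rw [h]
    positivity
  · rw [← integrable_comp_smul_iff volume _ (R := 2 * Real.pi) (by positivity)]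
    refine (integrable_congr (.of_forall (hF f g))).2 (Integrable.const_mul ?_ _)
    have h := L2.integrable_inner (𝕜 := ℂ) ((v g).toLp 2 volume) ((v f).toLp 2 volume)
    refine h.congr ?_
    filter_upwards [(v f).coeFn_toLp 2 volume, (v g).coeFn_toLp 2 volume] with x h1 h2
    rw [h1, h2]
    simp [mul_comm]
  · rw [covar_eq_inner_sub, hmean, zero_mul, sub_zero, hX, hX, inner_smul_left, inner_smul_right,
      hW.inner_eq]
    refine Eq.trans ?_ ((integral_angular _).trans
      (congrArg _ (integral_congr_ae (.of_forall (hF f g))))).symm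
    rw [integral_const_mul]
    -- Plancherel removes the outer Fourier transforms left by duality.
    have h := SchwartzMap.integral_inner_fourier_fourier (v g) (v f)
    simp only [RCLike.inner_apply'] at h
    rw [h, Complex.conj_ofReal]
    have : ((2 * Real.pi : ℂ)) ^ d ≠ 0 := by exact_mod_cast hpos.ne'
    field_simp

end SpectralDensity

/-! ### From test functions to point values by mollification -/

section Pointwise

variable {d : ℕ}

/-- Bump functions at the origin with radii tending to zero. -/
def shrinkingBump (d n : ℕ) : ContDiffBump (0 : Space d) where
  rIn := 1 / (n + 2)
  rOut := 1 / (n + 1)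
  rIn_pos := by positivity
  rIn_lt_rOut := by
    apply one_div_lt_one_div_of_lt <;> linarith [n.cast_nonneg (α := ℝ)]

/-- A nonnegative approximate identity centred at `s`. -/
def mollifierFun (n : ℕ) (s x : Space d) : ℝ :=
  (shrinkingBump d n).normed volume (s - x)

theorem contDiff_mollifierFun (n : ℕ) (s : Space d) : ContDiff ℝ ((⊤ : ℕ∞) : WithTop ℕ∞)
    fun x ↦ (mollifierFun n s x : ℂ) :=
  Complex.ofRealCLM.contDiff.comp
    ((shrinkingBump d n).contDiff_normed.comp (contDiff_const.sub contDiff_id))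

theorem hasCompactSupport_mollifierFun (n : ℕ) (s : Space d) :
    HasCompactSupport fun x ↦ (mollifierFun n s x : ℂ) :=
  ((shrinkingBump d n).hasCompactSupport_normed.comp_homeomorph (Homeomorph.subLeft s)).comp_left
    (g := Complex.ofReal) Complex.ofReal_zero

/-- The approximate identity as a sequence of test functions. -/
def mollifier (n : ℕ) (s : Space d) : 𝓢(Space d, ℂ) :=
  (hasCompactSupport_mollifierFun n s).toSchwartzMap (contDiff_mollifierFun n s)

theorem mollifier_apply (n : ℕ) (s x : Space d) : mollifier n s x = (mollifierFun n s x : ℂ) :=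
  rfl

theorem hasCompactSupport_mollifier (n : ℕ) (s : Space d) :
    HasCompactSupport (mollifier n s : Space d → ℂ) :=
  hasCompactSupport_mollifierFun n s

theorem tendsto_integral_mollifier_smul {E : Type*} [NormedAddCommGroup E] [NormedSpace ℂ E]
    [CompleteSpace E] {g : Space d → E} (hg : Continuous g) (s : Space d) :
    Filter.Tendsto (fun n ↦ ∫ x, mollifier n s x • g x) Filter.atTop (nhds (g s)) := by
  have h := ContDiffBump.convolution_tendsto_right_of_continuous (φ := shrinkingBump d)
    (μ := volume) (l := Filter.atTop) tendsto_one_div_add_atTop_nhds_zero_nat hg s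
  refine h.congr fun n ↦ ?_
  rw [convolution_eq_swap]
  refine integral_congr_ae (.of_forall fun x ↦ ?_)
  simp [mollifier_apply, mollifierFun]

/-- The exponential has modulus one and the bump is nonnegative with integral one. -/
theorem norm_angularTransform_mollifier_le (n : ℕ) (s k : Space d) :
    ‖angularTransform (mollifier n s) k‖ ≤ 1 := by
  refine (norm_integral_le_integral_norm _).trans_eq ?_
  have h : ∀ x, ‖Complex.exp (Complex.I * (inner ℝ k x : ℝ)) * mollifier n s x‖ =
      (shrinkingBump d n).normed volume (s - x) := fun x ↦ by
    rw [norm_mul, mul_comm Complex.I, Complex.norm_exp_ofReal_mul_I, one_mul, mollifier_apply,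
      mollifierFun, Complex.norm_real, Real.norm_of_nonneg ((shrinkingBump d n).nonneg_normed _)]
  simp only [h]
  rw [integral_sub_left_eq_self (fun x ↦ (shrinkingBump d n).normed volume x) volume s,
    ContDiffBump.integral_normed]

theorem tendsto_angularTransform_mollifier (s k : Space d) :
    Filter.Tendsto (fun n ↦ angularTransform (mollifier n s) k) Filter.atTop
      (nhds (Complex.exp (Complex.I * (inner ℝ k s : ℝ)))) := by
  refine (tendsto_integral_mollifier_smul (g := fun x : Space d ↦
    Complex.exp (Complex.I * (inner ℝ k x : ℝ))) (by fun_prop) s).congr fun n ↦ ?_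
  simp only [angularTransform, smul_eq_mul, mul_comm]

variable {Ω : Type*} [MeasurableSpace Ω] {P : Measure Ω}

theorem IsRepresentedBy.tendsto_mollifier {X : RandomField d P} {Y : Space d → Lp ℂ 2 P}
    (h : IsRepresentedBy X Y) (s : Space d) :
    Filter.Tendsto (fun n ↦ X (mollifier n s)) Filter.atTop (nhds (Y s)) := by
  refine (tendsto_integral_mollifier_smul h.1 s).congr fun n ↦ ?_
  exact (h.2 (mollifier n s) (hasCompactSupport_mollifier n s)).symm

/-- The integrand of the covariance of two mollified values of a field with spectral density
`S`. -/
def mollifiedDensity (S : Space d → ℝ) (s t : Space d) (n : ℕ) (k : Space d) : ℂ :=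
  angularTransform (mollifier n s) k *
    (starRingEnd ℂ) (angularTransform (mollifier n t) k) * (S k : ℂ)

theorem tendsto_mollifiedDensity (S : Space d → ℝ) (s t k : Space d) :
    Filter.Tendsto (fun n ↦ mollifiedDensity S s t n k) Filter.atTop
      (nhds (Complex.exp (Complex.I * (inner ℝ k (s - t) : ℝ)) * (S k : ℂ))) := by
  have h := ((tendsto_angularTransform_mollifier s k).mul
    ((Complex.continuous_conj.tendsto _).comp (tendsto_angularTransform_mollifier t k))).mul_const
    (S k : ℂ)
  have heq : Complex.exp (Complex.I * (inner ℝ k (s - t) : ℝ)) =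
      Complex.exp (Complex.I * (inner ℝ k s : ℝ)) *
        (starRingEnd ℂ) (Complex.exp (Complex.I * (inner ℝ k t : ℝ))) := by
    rw [← Complex.exp_conj, ← Complex.exp_add, inner_sub_right, map_mul, Complex.conj_I,
      Complex.conj_ofReal]
    push_cast
    ring_nf
  rw [heq]
  exact h

theorem norm_mollifiedDensity_le {S : Space d → ℝ} (hS : ∀ k, 0 ≤ S k) (s t : Space d) (n : ℕ)
    (k : Space d) : ‖mollifiedDensity S s t n k‖ ≤ S k := by
  rw [mollifiedDensity, norm_mul, norm_mul, RCLike.norm_conj, Complex.norm_real,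
    Real.norm_of_nonneg (hS k)]
  exact mul_le_of_le_one_left (hS k) (mul_le_one₀ (norm_angularTransform_mollifier_le _ _ _)
    (norm_nonneg _) (norm_angularTransform_mollifier_le _ _ _))

/-- On the diagonal the two transforms multiply to a squared modulus. Hence the covariance integral
equals the L¹ norm of its integrand, which is what Fatou's lemma needs. -/
theorem mollifiedDensity_self {S : Space d → ℝ} (hS : ∀ k, 0 ≤ S k) (s : Space d) (n : ℕ)
    (k : Space d) : mollifiedDensity S s s n k = (‖mollifiedDensity S s s n k‖ : ℂ) := by
  rw [mollifiedDensity, norm_mul, norm_mul, RCLike.norm_conj, Complex.norm_real,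
    Real.norm_of_nonneg (hS k), Complex.mul_conj']
  push_cast
  ring

theorem HasSpectralDensity.integrable_mollifiedDensity {X : RandomField d P} {S : Space d → ℝ}
    (hX : HasSpectralDensity X S) (s t : Space d) (n : ℕ) :
    Integrable (mollifiedDensity S s t n) :=
  (hX.2.2.2 (mollifier n s) (mollifier n t)).1

theorem HasSpectralDensity.covar_mollifier {X : RandomField d P} {S : Space d → ℝ}
    (hX : HasSpectralDensity X S) (s t : Space d) (n : ℕ) :
    covar (X (mollifier n s)) (X (mollifier n t)) = ∫ k, mollifiedDensity S s t n k :=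
  (hX.2.2.2 (mollifier n s) (mollifier n t)).2

variable [IsProbabilityMeasure P] {X : RandomField d P} {S : Space d → ℝ} {Y : Space d → Lp ℂ 2 P}

theorem HasSpectralDensity.tendsto_integral_mollifiedDensity (hX : HasSpectralDensity X S)
    (hY : IsRepresentedBy X Y) (s t : Space d) :
    Filter.Tendsto (fun n ↦ ∫ k, mollifiedDensity S s t n k) Filter.atTop
      (nhds (covar (Y s) (Y t))) := by
  have h := (continuous_covar.tendsto (Y s, Y t)).comp
    ((hY.tendsto_mollifier s).prodMk_nhds (hY.tendsto_mollifier t))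
  exact h.congr fun n ↦ hX.covar_mollifier s t n

/-- The spectral density of a mean-square continuous field is integrable, by Fatou's lemma. -/
theorem HasSpectralDensity.integrable (hX : HasSpectralDensity X S) (hY : IsRepresentedBy X Y) :
    Integrable S := by
  refine ⟨hX.1.aestronglyMeasurable, ?_⟩
  have hfatou : ∫⁻ k, ‖S k‖ₑ ≤
      Filter.liminf (fun n ↦ ∫⁻ k, ‖mollifiedDensity S 0 0 n k‖ₑ) Filter.atTop := by
    refine le_trans (le_of_eq ?_) (lintegral_liminf_le' fun n ↦
      (hX.integrable_mollifiedDensity 0 0 n).aestronglyMeasurable.enorm)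
    refine lintegral_congr fun k ↦ ?_
    rw [(tendsto_mollifiedDensity S 0 0 k).enorm.liminf_eq, sub_zero, inner_zero_right,
      Complex.ofReal_zero, mul_zero, Complex.exp_zero, one_mul, ← ofReal_norm, ← ofReal_norm,
      Complex.norm_real]
  have hval n : ∫⁻ k, ‖mollifiedDensity S 0 0 n k‖ₑ = ‖∫ k, mollifiedDensity S 0 0 n k‖ₑ := by
    have h2 : ∫ k, mollifiedDensity S 0 0 n k = ((∫ k, ‖mollifiedDensity S 0 0 n k‖ : ℝ) : ℂ) := by
      rw [← integral_complex_ofReal]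
      exact integral_congr_ae (.of_forall fun k ↦ mollifiedDensity_self hX.2.1 0 n k)
    rw [h2, ← ofReal_norm, Complex.norm_real,
      Real.norm_of_nonneg (integral_nonneg fun _ ↦ norm_nonneg _),
      ofReal_integral_norm_eq_lintegral_enorm (hX.integrable_mollifiedDensity 0 0 n)]
  simp only [hval] at hfatou
  -- Mean-square continuity makes these integrals converge to the finite variance of `Y 0`.
  rw [(hX.tendsto_integral_mollifiedDensity hY 0 0).enorm.liminf_eq] at hfatou
  exact hfatou.trans_lt enorm_lt_top

/-- If a generalized field with spectral density `S` is represented by a mean-square continuous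
field, then `S` is integrable and is the spectral density of that field. -/
theorem HasSpectralDensity.pointwise (hX : HasSpectralDensity X S) (hY : IsRepresentedBy X Y) :
    HasPointwiseSpectralDensity Y S := by
  refine ⟨hX.integrable hY, hX.2.1, ?_, fun s t ↦ ?_⟩
  · obtain ⟨m, hm⟩ := hX.2.2.1
    refine ⟨m, fun s ↦ ?_⟩
    have h1 := (continuous_integral_L2.tendsto (Y s)).comp (hY.tendsto_mollifier s)
    have h2 := (tendsto_integral_mollifier_smul
      (continuous_const (y := (1 : ℂ)) : Continuous fun _ : Space d ↦ (1 : ℂ)) s).const_mul m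
    simp only [smul_eq_mul, mul_one] at h2
    exact tendsto_nhds_unique h1 (h2.congr fun n ↦ (hm (mollifier n s)).symm)
  · exact tendsto_nhds_unique (hX.tendsto_integral_mollifiedDensity hY s t)
      (tendsto_integral_of_dominated_convergence S
        (fun n ↦ (hX.integrable_mollifiedDensity s t n).aestronglyMeasurable) (hX.integrable hY)
        (fun n ↦ .of_forall fun k ↦ norm_mollifiedDensity_le hX.2.1 s t n k)
        (.of_forall fun k ↦ tendsto_mollifiedDensity S s t k))

end Pointwise
end NestedSPDE

end

theorem proposition1 {Ω : Type*} [MeasurableSpace Ω] (P : Measure Ω) [IsProbabilityMeasure P]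
    (d n₁ n₂ : ℕ) (κ : Fin n₁ → ℝ) (hκ : ∀ i, 0 < κ i ^ 2) (α : Fin n₁ → ℕ)
    (b : Fin n₂ → ℝ) (B : Fin n₂ → NestedSPDE.Space d) (φ : ℝ)
    (W : NestedSPDE.RandomField d P) (hW : NestedSPDE.IsGaussianWhiteNoise W)
    (X : NestedSPDE.RandomField d P)
    (hX : NestedSPDE.opL₁ d (Lp ℂ 2 P) κ α X
      = NestedSPDE.opL₂ (Lp ℂ 2 P) b B ((φ : ℂ) • W))
    (S : NestedSPDE.Space d → ℝ)
    (hS : ∀ k : NestedSPDE.Space d,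
      S k = φ ^ 2 / (2 * Real.pi) ^ d *
        ((∏ j, (b j ^ 2 + k.ofLp ⬝ᵥ (Matrix.vecMulVec (B j).ofLp (B j).ofLp).mulVec k.ofLp)) /
          ∏ j, (κ j ^ 2 + ‖k‖ ^ 2) ^ α j)) :
    NestedSPDE.HasSpectralDensity X S ∧
      ∀ Y : NestedSPDE.Space d → Lp ℂ 2 P, NestedSPDE.IsRepresentedBy X Y →
        NestedSPDE.HasPointwiseSpectralDensity Y S := by
  have hSm : Measurable S := by
    rw [funext hS]
    refine measurable_const.mul ((Finset.measurable_prod _ fun j _ ↦ ?_).div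
      (Finset.measurable_prod _ fun j _ ↦ by fun_prop))
    simp only [Matrix.vecMulVec_mulVec]
    refine Continuous.measurable ?_
    simp only [dotProduct]
    fun_prop
  have hX' := NestedSPDE.eq_fourierMultiplierCLM_of_opL₁_eq_opL₂ hκ hX
  have h : NestedSPDE.HasSpectralDensity X S := by
    rw [hX']
    refine hW.hasSpectralDensity φ
      ((NestedSPDE.hasTemperateGrowth_prod fun j ↦ NestedSPDE.gradSymbol_hasTemperateGrowth _ _).mul
        (NestedSPDE.hasTemperateGrowth_prod fun i ↦
          NestedSPDE.maternSymbol_hasTemperateGrowth (hκ i) _)) hSm fun ξ ↦ ?_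
    rw [hS, Pi.mul_apply, norm_mul, mul_pow ‖_‖ ‖_‖, Finset.prod_apply, Finset.prod_apply, norm_prod,
      norm_prod, ← Finset.prod_pow, ← Finset.prod_pow, div_eq_mul_inv (∏ _, _), ← Finset.prod_inv_distrib]
    congr 2
    · exact Finset.prod_congr rfl fun j _ ↦ (NestedSPDE.norm_gradSymbol_sq _ _ _).symm
    · refine Finset.prod_congr rfl fun i _ ↦ ?_
      have hi := hκ i
      rw [Complex.norm_real, Real.norm_eq_abs, sq_abs, ← NestedSPDE.maternSymbol_sq hi, ← inv_pow,
        NestedSPDE.maternSymbol, NestedSPDE.maternSymbol, Real.rpow_neg (by positivity)]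
  exact ⟨h, fun Y hY ↦ h.pointwise hY⟩
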